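/- Let $\mathfrak g$ be a complex Lie algebra (possibly infinite-dimensional) with a triangular decomposition $\mathfrak g=\mathfrak n_-\oplus\mathfrak h\oplus\mathfrak n_+$ in the sense of Moody and Pianzola: $\mathfrak n_-,\mathfrak h,\mathfrak n_+$ are Lie subalgebras, $\mathfrak h$ is abelian, $\mathfrak n_+$ is the direct sum of its $\mathrm{ad}\,\mathfrak h$-weight spaces, all of whose weights lie in $Q_+\setminus\{0\}$, where $Q_+\subset\mathfrak h^*$ is the additive monoid generated by a linearly independent set, and there is an anti-involution $\sigma$ of $\mathfrak g$ that fixes $\mathfrak h$ pointwise and satisfies $\sigma(\mathfrak n_+)=\mathfrak n_-$. Put $\mathfrak n=\mathfrak n_+$. For $\mu\in\mathfrak h^*$ let $M(\mu)=U(\mathfrak g)\otimes_{U(\mathfrak h\oplus\mathfrak n_+)}\mathbb C_\mu$ be the Verma module with highest weight $\mu$, let $N(-\mu)=U(\mathfrak g)\otimes_{U(\mathfrak h\oplus\mathfrak n_-)}\mathbb C_{-\mu}$ be the lowest weight Verma module with lowest weight $-\mu$, and let $N(-\mu)^*$ be its full dual, with the action $(xf)(w)=f(-xw)$ for $x\in\mathfrak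 g$. For a Lie algebra homomorphism $\lambda:\mathfrak n\to\mathbb C$, that is, $\lambda\in(\mathfrak n/[\mathfrak n,\mathfrak n])^*$, let $L_\lambda=\mathbb C v_\lambda$ be the corresponding one-dimensional $\mathfrak n$-module, let $M_\lambda=U(\mathfrak g)\otimes_{U(\mathfrak n)}L_\lambda$, and for a $\mathfrak g$-module $X$ let $W_\lambda(X)=\{v\in X: xv=\lambda(x)v \text{ for all } x\in\mathfrak n\}$. Assume that $\mu\in\mathfrak h^*$ is such that $M(\mu)$ is simple, and let $\lambda\in(\mathfrak n/[\mathfrak n,\mathfrak n])^*$. Then the space $W_\lambda(N(-\mu)^*)$ is one-dimensional, and the image $L(\lambda,\mu)$ of the $\mathfrak g$-module homomorphism $M_\lambda\to N(-\mu)^*$ that sends $v_\lambda$ to a nonzero vector of $W_\lambda(N(-\mu)^*)$ (which is unique up to a scalar) satisfies $$\mathrm{Ann}_{U(\mathfrak g)}L(\lambda,\mu)=\mathrm{Ann}_{U(\mathfrak g)}M(\mu).$$ -/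

import Mathlib

open scoped TensorProduct

attribute [local instance 100] LieRing.ofAssociativeRing

noncomputable section

namespace WhittakerModules

section General

variable {g : Type*} [LieRing g] [LieAlgebra ℂ g]

/-- The annihilator in `U(g)` of a `g`-module `M`: the kernel of the representation
`U(g) → End(M)`. -/
def annihilator (g : Type*) [LieRing g] [LieAlgebra ℂ g] (M : Type*) [AddCommGroup M]
    [Module ℂ M] [LieRingModule g M] [LieModule ℂ g M] :
    Ideal (UniversalEnvelopingAlgebra ℂ g) :=
  RingHom.ker (UniversalEnvelopingAlgebra.lift ℂ (LieModule.toEnd ℂ g M))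

/-- The algebra homomorphism `U(s) → U(g)` coming from the inclusion of a subalgebra. -/
def envIncl (s : LieSubalgebra ℂ g) :
    UniversalEnvelopingAlgebra ℂ s →ₐ[ℂ] UniversalEnvelopingAlgebra ℂ g :=
  UniversalEnvelopingAlgebra.lift ℂ ((UniversalEnvelopingAlgebra.ι ℂ).comp s.incl)

/-- The representation of a Lie algebra `s` on the one-dimensional space `ℂ` given by a
character. -/
def charRep {s : Type*} [LieRing s] [LieAlgebra ℂ s] (χ : LieAlgebra.LieCharacter ℂ s) :
    s →ₗ⁅ℂ⁆ Module.End ℂ ℂ where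
  toFun x := χ x • LinearMap.id
  map_add' x y := by simp [add_smul]
  map_smul' c x := by simp [mul_smul]
  map_lie' {x y} := by
    ext
    simp [LieRing.of_associative_ring_bracket, mul_comm]

section Induced

variable {V : Type*} [AddCommGroup V] [Module ℂ V]

/-- The `U(s)`-balancing relations `u a ⊗ v = u ⊗ a v` in `U(g) ⊗_ℂ V`, for a representation
`φ` of a subalgebra `s` on `V`. -/
def balancing (s : LieSubalgebra ℂ g) (φ : s →ₗ⁅ℂ⁆ Module.End ℂ V) :
    Submodule (UniversalEnvelopingAlgebra ℂ g) (UniversalEnvelopingAlgebra ℂ g ⊗[ℂ] V) :=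
  Submodule.span _ {t | ∃ (u : UniversalEnvelopingAlgebra ℂ g)
    (a : UniversalEnvelopingAlgebra ℂ s) (v : V),
    t = (u * envIncl s a) ⊗ₜ[ℂ] v
      - u ⊗ₜ[ℂ] (UniversalEnvelopingAlgebra.lift ℂ φ a v)}

/-- The induced module `U(g) ⊗_{U(s)} V`, with its left action of `U(g)`. -/
def Induced (s : LieSubalgebra ℂ g) (φ : s →ₗ⁅ℂ⁆ Module.End ℂ V) : Type _ :=
  (UniversalEnvelopingAlgebra ℂ g ⊗[ℂ] V) ⧸ balancing s φ

namespace Induced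

variable (s : LieSubalgebra ℂ g) (φ : s →ₗ⁅ℂ⁆ Module.End ℂ V)

instance : AddCommGroup (Induced s φ) :=
  inferInstanceAs (AddCommGroup ((UniversalEnvelopingAlgebra ℂ g ⊗[ℂ] V) ⧸ balancing s φ))

instance : Module (UniversalEnvelopingAlgebra ℂ g) (Induced s φ) :=
  inferInstanceAs (Module (UniversalEnvelopingAlgebra ℂ g)
    ((UniversalEnvelopingAlgebra ℂ g ⊗[ℂ] V) ⧸ balancing s φ))

instance : Module ℂ (Induced s φ) :=
  inferInstanceAs (Module ℂ ((UniversalEnvelopingAlgebra ℂ g ⊗[ℂ] V) ⧸ balancing s φ))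

instance : IsScalarTower ℂ (UniversalEnvelopingAlgebra ℂ g) (Induced s φ) :=
  inferInstanceAs (IsScalarTower ℂ (UniversalEnvelopingAlgebra ℂ g)
    ((UniversalEnvelopingAlgebra ℂ g ⊗[ℂ] V) ⧸ balancing s φ))

/-- The class of the tensor `u ⊗ v`. -/
def tmul (u : UniversalEnvelopingAlgebra ℂ g) (v : V) : Induced s φ :=
  (balancing s φ).mkQ (u ⊗ₜ[ℂ] v)

instance : LieRingModule g (Induced s φ) where
  bracket x m := UniversalEnvelopingAlgebra.ι ℂ x • m
  add_lie x y m := by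
    change UniversalEnvelopingAlgebra.ι ℂ (x + y) • m = _
    rw [map_add, add_smul]
  lie_add x m n := smul_add _ m n
  leibniz_lie x y m := by
    change UniversalEnvelopingAlgebra.ι ℂ x • (UniversalEnvelopingAlgebra.ι ℂ y • m)
      = UniversalEnvelopingAlgebra.ι ℂ ⁅x, y⁆ • m
        + UniversalEnvelopingAlgebra.ι ℂ y • (UniversalEnvelopingAlgebra.ι ℂ x • m)
    rw [LieHom.map_lie, LieRing.of_associative_ring_bracket, sub_smul, mul_smul, mul_smul]
    abel

instance : LieModule ℂ g (Induced s φ) where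
  smul_lie c x m := by
    change UniversalEnvelopingAlgebra.ι ℂ (c • x) • m
      = c • (UniversalEnvelopingAlgebra.ι ℂ x • m)
    rw [map_smul, smul_assoc]
  lie_smul c x m := by
    change UniversalEnvelopingAlgebra.ι ℂ x • (c • m)
      = c • (UniversalEnvelopingAlgebra.ι ℂ x • m)
    rw [← algebraMap_smul (UniversalEnvelopingAlgebra ℂ g) c m,
      ← algebraMap_smul (UniversalEnvelopingAlgebra ℂ g) c
        (UniversalEnvelopingAlgebra.ι ℂ x • m), ← mul_smul, ← mul_smul, Algebra.commutes]

end Induced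

end Induced

section Whittaker

variable (n : LieSubalgebra ℂ g) (χ : LieAlgebra.LieCharacter ℂ n)

/-- The standard Whittaker module `M_λ = U(g) ⊗_{U(n)} L_λ`, where `L_λ` is the
one-dimensional `n`-module `ℂ` given by the character `λ`, with basis vector `1`. -/
abbrev StandardWhittaker : Type _ := Induced n (charRep χ)

/-- The generator `1 ⊗ v_λ` of `M_λ`. -/
def standardGenerator : StandardWhittaker n χ := Induced.tmul n (charRep χ) 1 1

variable (M : Type*) [AddCommGroup M] [Module ℂ M] [LieRingModule g M] [LieModule ℂ g M]

/-- The space `W_λ(M)` of the vectors of `M` on which `n` acts through the character `λ`. -/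
def whittakerVectors : Submodule ℂ M where
  carrier := {m | ∀ x : n, ⁅(x : g), m⁆ = χ x • m}
  zero_mem' x := by simp
  add_mem' ha hb x := by rw [lie_add, ha x, hb x, smul_add]
  smul_mem' c m hm x := by rw [lie_smul, hm x, smul_comm]

variable {n χ M}

/-- The map `U(g) ⊗_ℂ L_λ → M`, `u ⊗ z ↦ z u w`. -/
def preWhittakerHom (w : M) :
    (UniversalEnvelopingAlgebra ℂ g ⊗[ℂ] ℂ) →ₛₗ[((UniversalEnvelopingAlgebra.lift ℂ
      (LieModule.toEnd ℂ g M) : UniversalEnvelopingAlgebra ℂ g →ₐ[ℂ] Module.End ℂ M) :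
      UniversalEnvelopingAlgebra ℂ g →+* Module.End ℂ M)] M where
  toFun t := UniversalEnvelopingAlgebra.lift ℂ (LieModule.toEnd ℂ g M)
    (TensorProduct.rid ℂ (UniversalEnvelopingAlgebra ℂ g) t) w
  map_add' a b := by simp
  map_smul' u t := by
    have h : TensorProduct.rid ℂ (UniversalEnvelopingAlgebra ℂ g) (u • t)
        = u * TensorProduct.rid ℂ (UniversalEnvelopingAlgebra ℂ g) t := by
      induction t with
      | zero => simp
      | tmul a z => simp [TensorProduct.smul_tmul']
      | add a b ha hb => rw [smul_add, map_add, ha, hb, map_add, mul_add]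
    rw [h, map_mul]
    rfl

theorem lift_envIncl_apply (w : M) (hw : w ∈ whittakerVectors n χ M)
    (a : UniversalEnvelopingAlgebra ℂ n) :
    UniversalEnvelopingAlgebra.lift ℂ (LieModule.toEnd ℂ g M) (envIncl n a) w
      = (UniversalEnvelopingAlgebra.lift ℂ (charRep χ) a 1) • w := by
  have hs : ∀ (b : UniversalEnvelopingAlgebra ℂ n) (z : ℂ),
      UniversalEnvelopingAlgebra.lift ℂ (charRep χ) b z
        = z * UniversalEnvelopingAlgebra.lift ℂ (charRep χ) b 1 := by
    intro b z
    rw [← smul_eq_mul, ← map_smul, smul_eq_mul, mul_one]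
  let S : Subalgebra ℂ (UniversalEnvelopingAlgebra ℂ n) :=
    { carrier := {a | UniversalEnvelopingAlgebra.lift ℂ (LieModule.toEnd ℂ g M)
        (envIncl n a) w = (UniversalEnvelopingAlgebra.lift ℂ (charRep χ) a 1) • w}
      mul_mem' := by
        intro a b ha hb
        simp only [Set.mem_ofPred_eq] at ha hb ⊢
        rw [map_mul, map_mul, map_mul, Module.End.mul_apply, Module.End.mul_apply, hb,
          map_smul, ha, hs a (UniversalEnvelopingAlgebra.lift ℂ (charRep χ) b 1), mul_smul]
      add_mem' := by
        intro a b ha hb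
        simp only [Set.mem_ofPred_eq] at ha hb ⊢
        rw [map_add, map_add, map_add, LinearMap.add_apply, LinearMap.add_apply, ha, hb,
          add_smul]
      algebraMap_mem' := by
        intro c
        simp }
  have hι : ∀ x : n, UniversalEnvelopingAlgebra.ι ℂ x ∈ S := by
    intro x
    change UniversalEnvelopingAlgebra.lift ℂ (LieModule.toEnd ℂ g M)
      (envIncl n (UniversalEnvelopingAlgebra.ι ℂ x)) w
      = (UniversalEnvelopingAlgebra.lift ℂ (charRep χ) (UniversalEnvelopingAlgebra.ι ℂ x) 1) • w
    rw [envIncl, UniversalEnvelopingAlgebra.lift_ι_apply, UniversalEnvelopingAlgebra.lift_ι_apply]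
    change UniversalEnvelopingAlgebra.lift ℂ (LieModule.toEnd ℂ g M)
      (UniversalEnvelopingAlgebra.ι ℂ (x : g)) w = (χ x • (1 : ℂ)) • w
    rw [UniversalEnvelopingAlgebra.lift_ι_apply, smul_eq_mul, mul_one]
    exact hw x
  let F : n →ₗ⁅ℂ⁆ S :=
    { toFun := fun x => ⟨UniversalEnvelopingAlgebra.ι ℂ x, hι x⟩
      map_add' := fun x y => Subtype.ext (map_add _ x y)
      map_smul' := fun c x => Subtype.ext (map_smul _ c x)
      map_lie' := fun {x y} => Subtype.ext (LieHom.map_lie _ x y) }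
  have hF : S.val.comp (UniversalEnvelopingAlgebra.lift ℂ F) = AlgHom.id ℂ _ := by
    apply UniversalEnvelopingAlgebra.hom_ext
    ext x
    change ((UniversalEnvelopingAlgebra.lift ℂ F (UniversalEnvelopingAlgebra.ι ℂ x) : S) :
      UniversalEnvelopingAlgebra ℂ n) = UniversalEnvelopingAlgebra.ι ℂ x
    rw [UniversalEnvelopingAlgebra.lift_ι_apply]
    rfl
  have h := (UniversalEnvelopingAlgebra.lift ℂ F a).2
  have h2 : ((UniversalEnvelopingAlgebra.lift ℂ F a : S) : UniversalEnvelopingAlgebra ℂ n) = a :=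
    DFunLike.congr_fun hF a
  rw [h2] at h
  exact h

theorem balancing_le_ker (w : M) (hw : w ∈ whittakerVectors n χ M) :
    balancing n (charRep χ) ≤ LinearMap.ker (preWhittakerHom (g := g) w) := by
  refine Submodule.span_le.2 ?_
  rintro _ ⟨u, a, v, rfl⟩
  have hv : UniversalEnvelopingAlgebra.lift ℂ (charRep χ) a v
      = v * UniversalEnvelopingAlgebra.lift ℂ (charRep χ) a 1 := by
    rw [← smul_eq_mul, ← map_smul, smul_eq_mul, mul_one]
  change preWhittakerHom (g := g) w _ = 0
  rw [map_sub, sub_eq_zero, hv]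
  simp [preWhittakerHom, lift_envIncl_apply w hw, mul_smul]

/-- The homomorphism of `g`-modules `M_λ → M` that sends `v_λ` to a given vector `w` of
`W_λ(M)`, that is, `u ⊗ v_λ ↦ u w`. -/
def whittakerHom (w : whittakerVectors n χ M) : StandardWhittaker n χ →ₗ⁅ℂ,g⁆ M where
  toFun := (balancing n (charRep χ)).liftQ (preWhittakerHom (w : M))
    (balancing_le_ker (w : M) w.2)
  map_add' := map_add _
  map_smul' c m := by
    rw [← algebraMap_smul (UniversalEnvelopingAlgebra ℂ g) c m]
    refine (map_smulₛₗ ((balancing n (charRep χ)).liftQ (preWhittakerHom (w : M))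
      (balancing_le_ker (w : M) w.2)) _ m).trans ?_
    simp
    rfl
  map_lie' {x m} := by
    refine (map_smulₛₗ ((balancing n (charRep χ)).liftQ (preWhittakerHom (w : M))
      (balancing_le_ker (w : M) w.2)) (UniversalEnvelopingAlgebra.ι ℂ x) m).trans ?_
    simp
    rfl

theorem whittakerHom_generator (w : whittakerVectors n χ M) :
    whittakerHom w (standardGenerator n χ) = (w : M) := by
  change preWhittakerHom (w : M) _ = _
  simp [preWhittakerHom]

end Whittaker

end General

variable (g : Type*) [LieRing g] [LieAlgebra ℂ g]

/-- The subspace of weight `β` of `g` for the adjoint action of a subalgebra `h`. -/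
def rootSpace {g : Type*} [LieRing g] [LieAlgebra ℂ g] (h : LieSubalgebra ℂ g)
    (β : Module.Dual ℂ h) : Submodule ℂ g where
  carrier := {x | ∀ y : h, ⁅(y : g), x⁆ = β y • x}
  zero_mem' y := by simp
  add_mem' ha hb y := by rw [lie_add, ha y, hb y, smul_add]
  smul_mem' c x hx y := by rw [lie_smul, hx y, smul_comm]

/-- A triangular decomposition `g = n₋ ⊕ h ⊕ n₊` of a complex Lie algebra in the sense of
Moody and Pianzola. Neither the number of simple roots nor the dimensions of the root spaces
are assumed to be finite. -/
structure TriangularDecomposition where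
  /-- The subalgebra `n₋`. -/
  neg : LieSubalgebra ℂ g
  /-- The subalgebra `h`. -/
  cartan : LieSubalgebra ℂ g
  /-- The subalgebra `n₊`. -/
  pos : LieSubalgebra ℂ g
  /-- `g` is the direct sum of the three subalgebras as a vector space. -/
  isInternal : DirectSum.IsInternal ![neg.toSubmodule, cartan.toSubmodule, pos.toSubmodule]
  /-- `h` is abelian. -/
  cartan_abelian : ∀ x ∈ cartan, ∀ y ∈ cartan, ⁅x, y⁆ = 0
  /-- The basis of the free additive monoid `Q₊ ⊆ h*`. -/
  simpleRoots : Set (Module.Dual ℂ cartan)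
  /-- The simple roots are linearly independent. -/
  linearIndepOn : LinearIndepOn ℂ id simpleRoots
  /-- `n₊` is the sum of its subspaces of weights from `Q₊ \ {0}`. -/
  pos_eq : pos.toSubmodule = ⨆ β ∈ {β : Module.Dual ℂ cartan |
    β ∈ AddSubmonoid.closure simpleRoots ∧ β ≠ 0}, rootSpace cartan β ⊓ pos.toSubmodule
  /-- The anti-involution `σ`. -/
  sigma : g →ₗ[ℂ] g
  sigma_lie : ∀ x y, sigma ⁅x, y⁆ = ⁅sigma y, sigma x⁆
  sigma_sigma : ∀ x, sigma (sigma x) = x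
  /-- `σ` fixes `h` pointwise. -/
  sigma_cartan : ∀ x ∈ cartan, sigma x = x
  /-- `σ` maps `n₊` onto `n₋`. -/
  map_sigma : pos.toSubmodule.map sigma = neg.toSubmodule

namespace TriangularDecomposition

variable {g} (T : TriangularDecomposition g)

theorem cartan_lie_pos : ∀ x ∈ T.cartan, ∀ y ∈ T.pos, ⁅x, y⁆ ∈ T.pos := by
  intro x hx y hy
  have hy' : y ∈ ⨆ β ∈ {β : Module.Dual ℂ T.cartan |
    β ∈ AddSubmonoid.closure T.simpleRoots ∧ β ≠ 0},
      rootSpace T.cartan β ⊓ T.pos.toSubmodule := T.pos_eq ▸ hy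
  have hle : (⨆ β ∈ {β : Module.Dual ℂ T.cartan |
    β ∈ AddSubmonoid.closure T.simpleRoots ∧ β ≠ 0},
      rootSpace T.cartan β ⊓ T.pos.toSubmodule) ≤
        T.pos.toSubmodule.comap (LieAlgebra.ad ℂ g x : g →ₗ[ℂ] g) := by
    refine iSup₂_le fun β _ z hz => ?_
    have h1 : ⁅x, z⁆ = β ⟨x, hx⟩ • z := hz.1 ⟨x, hx⟩
    change ⁅x, z⁆ ∈ T.pos.toSubmodule
    rw [h1]
    exact T.pos.toSubmodule.smul_mem _ hz.2
  exact hle hy'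

theorem cartan_lie_neg : ∀ x ∈ T.cartan, ∀ y ∈ T.neg, ⁅x, y⁆ ∈ T.neg := by
  intro x hx y hy
  have hy' : y ∈ T.pos.toSubmodule.map T.sigma := T.map_sigma.symm ▸ hy
  obtain ⟨z, hz, rfl⟩ := hy'
  have h1 : ⁅x, T.sigma z⁆ = T.sigma (-⁅x, z⁆) := by
    rw [lie_skew, T.sigma_lie, T.sigma_cartan x hx]
  have h2 : T.sigma (-⁅x, z⁆) ∈ T.pos.toSubmodule.map T.sigma :=
    ⟨_, T.pos.toSubmodule.neg_mem (T.cartan_lie_pos x hx z hz), rfl⟩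
  rw [h1]
  rw [T.map_sigma] at h2
  exact h2

theorem isCompl_cartan :
    IsCompl T.cartan.toSubmodule (T.neg.toSubmodule ⊔ T.pos.toSubmodule) := by
  have h := (DirectSum.isInternal_submodule_iff_iSupIndep_and_iSup_eq_top _).1 T.isInternal
  have h1 : (⨆ j, ⨆ (_ : j ≠ (1 : Fin 3)),
      (![T.neg.toSubmodule, T.cartan.toSubmodule, T.pos.toSubmodule] j))
      = T.neg.toSubmodule ⊔ T.pos.toSubmodule := by
    apply le_antisymm
    · refine iSup₂_le fun j hj => ?_
      fin_cases j
      · exact le_sup_left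
      · exact absurd rfl hj
      · exact le_sup_right
    · exact sup_le (le_iSup₂_of_le (0 : Fin 3) (by decide) le_rfl)
        (le_iSup₂_of_le (2 : Fin 3) (by decide) le_rfl)
  refine ⟨?_, codisjoint_iff_le_sup.2 ?_⟩
  · have h2 := h.1 1
    rw [h1] at h2
    exact h2
  · rw [← h.2]
    refine iSup_le fun j => ?_
    fin_cases j
    · exact le_sup_left.trans le_sup_right
    · exact le_sup_left
    · exact le_sup_right.trans le_sup_right

/-- The projection of `g` onto `h` along `n₋ ⊕ n₊`. -/
def proj : g →ₗ[ℂ] T.cartan := Submodule.projectionOnto _ _ T.isCompl_cartan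

theorem proj_cartan (x : T.cartan) : T.proj (x : g) = x :=
  Submodule.projectionOnto_apply_left T.isCompl_cartan x

/-- The subalgebra `h ⊕ n` for a subalgebra `n` of `g` normalized by `h`. -/
def borel (n : LieSubalgebra ℂ g) (hn : ∀ x ∈ T.cartan, ∀ y ∈ n, ⁅x, y⁆ ∈ n) :
    LieSubalgebra ℂ g where
  toSubmodule := T.cartan.toSubmodule ⊔ n.toSubmodule
  lie_mem' := by
    intro x y hx hy
    obtain ⟨a, ha, b, hb, rfl⟩ := Submodule.mem_sup.1 hx
    obtain ⟨c, hc, d, hd, rfl⟩ := Submodule.mem_sup.1 hy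
    refine Submodule.mem_sup_right ?_
    rw [add_lie, lie_add, lie_add, T.cartan_abelian a ha c hc, zero_add, ← lie_skew b c]
    exact n.toSubmodule.add_mem (hn a ha d hd)
      (n.toSubmodule.add_mem (n.toSubmodule.neg_mem (hn c hc b hb)) (n.lie_mem hb hd))

/-- The character `x + y ↦ ν(x)`, for `x ∈ h` and `y ∈ n`, of the subalgebra `h ⊕ n`, where
`n` is contained in `n₋ ⊕ n₊` (it is `n₊` or `n₋` below). -/
def borelChar (n : LieSubalgebra ℂ g) (hn : ∀ x ∈ T.cartan, ∀ y ∈ n, ⁅x, y⁆ ∈ n)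
    (hle : n.toSubmodule ≤ T.neg.toSubmodule ⊔ T.pos.toSubmodule)
    (ν : Module.Dual ℂ T.cartan) : LieAlgebra.LieCharacter ℂ (T.borel n hn) where
  toLinearMap := ν ∘ₗ T.proj ∘ₗ (T.borel n hn).toSubmodule.subtype
  map_lie' {x y} := by
    have key : ∀ z ∈ n, T.proj z = 0 := fun z hz =>
      (Submodule.projectionOnto_apply_eq_zero_iff T.isCompl_cartan).2 (hle hz)
    obtain ⟨x, hx⟩ := x
    obtain ⟨y, hy⟩ := y
    obtain ⟨a, ha, b, hb, rfl⟩ := Submodule.mem_sup.1 hx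
    obtain ⟨c, hc, d, hd, rfl⟩ := Submodule.mem_sup.1 hy
    have h1 : ⁅a + b, c + d⁆ ∈ n := by
      rw [add_lie, lie_add, lie_add, T.cartan_abelian a ha c hc, zero_add, ← lie_skew b c]
      exact n.toSubmodule.add_mem (hn a ha d hd)
        (n.toSubmodule.add_mem (n.toSubmodule.neg_mem (hn c hc b hb)) (n.lie_mem hb hd))
    rw [LieRing.of_associative_ring_bracket, mul_comm, sub_self]
    change ν (T.proj ⁅a + b, c + d⁆) = 0
    rw [key _ h1, map_zero]

/-- The Verma module `M(μ) = U(g) ⊗_{U(h ⊕ n₊)} ℂ_μ` with highest weight `μ`. -/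
abbrev Verma (μ : Module.Dual ℂ T.cartan) : Type _ :=
  Induced (T.borel T.pos T.cartan_lie_pos)
    (charRep (T.borelChar T.pos T.cartan_lie_pos le_sup_right μ))

/-- The lowest weight Verma module `N(ν) = U(g) ⊗_{U(h ⊕ n₋)} ℂ_ν` with lowest weight `ν`. -/
abbrev LowestVerma (ν : Module.Dual ℂ T.cartan) : Type _ :=
  Induced (T.borel T.neg T.cartan_lie_neg)
    (charRep (T.borelChar T.neg T.cartan_lie_neg le_sup_left ν))

/-- The full dual `N(-μ)*`, with the action `(x f)(w) = f(-x w)` of `g`. -/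
abbrev DualLowestVerma (μ : Module.Dual ℂ T.cartan) : Type _ :=
  Module.Dual ℂ (T.LowestVerma (-μ))

/-- For a Whittaker vector `w ∈ W_λ(N(-μ)*)`, the image of the homomorphism `M_λ → N(-μ)*`
with `v_λ ↦ w`. For `w ≠ 0` this is the module `L(λ, μ)`. -/
def whittakerImage (μ : Module.Dual ℂ T.cartan) (χ : LieAlgebra.LieCharacter ℂ T.pos)
    (w : whittakerVectors T.pos χ (T.DualLowestVerma μ)) :
    LieSubmodule ℂ g (T.DualLowestVerma μ) :=
  (whittakerHom w).range

end TriangularDecomposition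

end WhittakerModules

end

/-! Since g = n ⊕ (h ⊕ n₋), the module N(-μ) is U(n)v for its lowest weight vector v. A functional f
with xf = λ(x)f satisfies f(xw) = -λ(x)f(w) for x in n, so f is determined by f(v)
(`whittaker_functional_ext`). Conversely, the character of U(n) extending -λ gives such an f with
f(v) = 1, once N(-μ) is mapped to U(n) compatibly with n and with v ↦ 1
(`exists_whittaker_functional`). Instead of the PBW theorem, this map uses an explicit action of g
on U(n) (`envelopeRep`) and the universal property of induction. Hence W_λ(N(-μ)*) is a line.

For the annihilators, twisting by -σ exchanges highest and lowest weights, so simplicity of M(μ)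
gives simplicity of N(-μ) (`isIrreducible_lowestVerma`). If N is simple and P is a nonzero submodule
of N*, the common kernel of the functionals in P is a submodule other than N, hence 0. An element u
of U(g) acts on N* as the transpose of some u' acting on N, so if u kills P then u'N = 0, and u
kills all of N*. Thus all nonzero submodules of N* have the same annihilator
(`annihilator_eq_of_dual`).

L(λ,μ) is one such submodule. A copy of M(μ) is another: the case λ = 0 yields a functional of
highest weight μ, hence a nonzero map M(μ) → N(-μ)*, injective by simplicity
(`exists_injective_verma`). -/

noncomputable section

namespace WhittakerModules

/-! ### Enveloping algebras, annihilators and irreducibility -/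

section Envelope

variable {L : Type*} [LieRing L] [LieAlgebra ℂ L]

/-- A subspace of `U(L)` that contains `1` and is stable under left multiplication by `L` is all
of `U(L)`. -/
theorem envelope_submodule_eq_top (S : Submodule ℂ (UniversalEnvelopingAlgebra ℂ L))
    (one : (1 : UniversalEnvelopingAlgebra ℂ L) ∈ S)
    (mul : ∀ (x : L), ∀ u ∈ S, UniversalEnvelopingAlgebra.ι ℂ x * u ∈ S) : S = ⊤ := by
  -- The elements whose left multiplication preserves `S` form a subalgebra containing L. By the
  -- universal property, L → `B` extends to U(L) → `B`, and following it by the inclusion gives the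
  -- identity; so `B` is everything, and applying its elements to 1 gives the claim.
  let B : Subalgebra ℂ (UniversalEnvelopingAlgebra ℂ L) :=
    { carrier := {a | ∀ u ∈ S, a * u ∈ S}
      mul_mem' := fun {a b} ha hb u hu => by
        rw [mul_assoc]
        exact ha _ (hb u hu)
      add_mem' := fun {a b} ha hb u hu => by
        rw [add_mul]
        exact S.add_mem (ha u hu) (hb u hu)
      algebraMap_mem' := fun c u hu => by
        rw [← Algebra.smul_def]
        exact S.smul_mem c hu }
  let F : L →ₗ⁅ℂ⁆ B :=
    { toFun := fun x => ⟨UniversalEnvelopingAlgebra.ι ℂ x, mul x⟩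
      map_add' := fun x y => Subtype.ext (map_add _ x y)
      map_smul' := fun c x => Subtype.ext (map_smul _ c x)
      map_lie' := fun {x y} => Subtype.ext (LieHom.map_lie _ x y) }
  have hF : B.val.comp (UniversalEnvelopingAlgebra.lift ℂ F) = AlgHom.id ℂ _ := by
    apply UniversalEnvelopingAlgebra.hom_ext
    ext x
    change ((UniversalEnvelopingAlgebra.lift ℂ F (UniversalEnvelopingAlgebra.ι ℂ x) : B) :
      UniversalEnvelopingAlgebra ℂ L) = UniversalEnvelopingAlgebra.ι ℂ x
    rw [UniversalEnvelopingAlgebra.lift_ι_apply]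
    rfl
  rw [eq_top_iff]
  intro a _
  have h := (UniversalEnvelopingAlgebra.lift ℂ F a).2
  have h2 : ((UniversalEnvelopingAlgebra.lift ℂ F a : B) : UniversalEnvelopingAlgebra ℂ L) = a :=
    DFunLike.congr_fun hF a
  rw [h2] at h
  simpa using h 1 one

variable {M N : Type*} [AddCommGroup M] [Module ℂ M] [LieRingModule L M] [LieModule ℂ L M]
  [AddCommGroup N] [Module ℂ N] [LieRingModule L N] [LieModule ℂ L N]

theorem lift_toEnd_ι_mul (x : L) (u : UniversalEnvelopingAlgebra ℂ L) (m : M) :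
    UniversalEnvelopingAlgebra.lift ℂ (LieModule.toEnd ℂ L M)
      (UniversalEnvelopingAlgebra.ι ℂ x * u) m
      = ⁅x, UniversalEnvelopingAlgebra.lift ℂ (LieModule.toEnd ℂ L M) u m⁆ := by
  rw [map_mul, Module.End.mul_apply, UniversalEnvelopingAlgebra.lift_ι_apply,
    LieModule.toEnd_apply_apply]

theorem mem_annihilator {u : UniversalEnvelopingAlgebra ℂ L} :
    u ∈ annihilator L M ↔
      ∀ m : M, UniversalEnvelopingAlgebra.lift ℂ (LieModule.toEnd ℂ L M) u m = 0 := by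
  rw [annihilator, RingHom.mem_ker]
  exact LinearMap.ext_iff

theorem map_lift_toEnd (f : M →ₗ⁅ℂ,L⁆ N) (u : UniversalEnvelopingAlgebra ℂ L) (m : M) :
    f (UniversalEnvelopingAlgebra.lift ℂ (LieModule.toEnd ℂ L M) u m)
      = UniversalEnvelopingAlgebra.lift ℂ (LieModule.toEnd ℂ L N) u (f m) := by
  let S : Submodule ℂ (UniversalEnvelopingAlgebra ℂ L) :=
    { carrier := {u | f (UniversalEnvelopingAlgebra.lift ℂ (LieModule.toEnd ℂ L M) u m)
        = UniversalEnvelopingAlgebra.lift ℂ (LieModule.toEnd ℂ L N) u (f m)}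
      zero_mem' := by simp
      add_mem' := fun {a b} ha hb => by
        simp only [Set.mem_ofPred_eq] at ha hb ⊢
        simp [ha, hb]
      smul_mem' := fun c a ha => by
        simp only [Set.mem_ofPred_eq] at ha ⊢
        simp [ha] }
  have hS : S = ⊤ := envelope_submodule_eq_top S (by simp [S]) fun x u hu => by
    change f _ = _ at hu
    change f _ = _
    rw [lift_toEnd_ι_mul, lift_toEnd_ι_mul, LieModuleHom.map_lie, hu]
  have hu : u ∈ S := hS ▸ Submodule.mem_top
  exact hu

theorem annihilator_range_of_injective (f : M →ₗ⁅ℂ,L⁆ N) (hf : Function.Injective f) :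
    annihilator L f.range = annihilator L M := by
  ext u
  have key : ∀ y : f.range,
      ((UniversalEnvelopingAlgebra.lift ℂ (LieModule.toEnd ℂ L f.range) u y : f.range) : N)
        = UniversalEnvelopingAlgebra.lift ℂ (LieModule.toEnd ℂ L N) u (y : N) :=
    fun y => map_lift_toEnd f.range.incl u y
  rw [mem_annihilator, mem_annihilator]
  constructor
  · intro h m
    apply hf
    have h1 := key ⟨f m, (LieModuleHom.mem_range f _).2 ⟨m, rfl⟩⟩
    rw [h] at h1
    rw [map_lift_toEnd, map_zero]
    exact h1.symm
  · rintro h ⟨y, hy⟩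
    obtain ⟨m, rfl⟩ := (LieModuleHom.mem_range f _).1 hy
    apply Subtype.ext
    rw [key]
    change UniversalEnvelopingAlgebra.lift ℂ (LieModule.toEnd ℂ L N) u (f m) = 0
    rw [← map_lift_toEnd, h, map_zero]

/-- The action of an element of `U(L)` on the dual of a module is the transpose of the action of
some element of `U(L)`, its image under the antipode. -/
theorem exists_transpose (N : Type*) [AddCommGroup N] [Module ℂ N] [LieRingModule L N]
    [LieModule ℂ L N] (u : UniversalEnvelopingAlgebra ℂ L) :
    ∃ u' : UniversalEnvelopingAlgebra ℂ L, ∀ (f : Module.Dual ℂ N) (w : N),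
      UniversalEnvelopingAlgebra.lift ℂ (LieModule.toEnd ℂ L (Module.Dual ℂ N)) u f w
        = f (UniversalEnvelopingAlgebra.lift ℂ (LieModule.toEnd ℂ L N) u' w) := by
  let S : Submodule ℂ (UniversalEnvelopingAlgebra ℂ L) :=
    { carrier := {u | ∃ u' : UniversalEnvelopingAlgebra ℂ L, ∀ (f : Module.Dual ℂ N) (w : N),
        UniversalEnvelopingAlgebra.lift ℂ (LieModule.toEnd ℂ L (Module.Dual ℂ N)) u f w
          = f (UniversalEnvelopingAlgebra.lift ℂ (LieModule.toEnd ℂ L N) u' w)}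
      zero_mem' := ⟨0, by simp⟩
      add_mem' := by
        rintro a b ⟨a', ha⟩ ⟨b', hb⟩
        refine ⟨a' + b', fun f w => ?_⟩
        rw [map_add, map_add, LinearMap.add_apply, LinearMap.add_apply, LinearMap.add_apply,
          map_add, ha, hb]
      smul_mem' := by
        rintro c a ⟨a', ha⟩
        refine ⟨c • a', fun f w => ?_⟩
        rw [map_smul, map_smul, LinearMap.smul_apply, LinearMap.smul_apply, LinearMap.smul_apply,
          map_smul, ha] }
  have hS : S = ⊤ := by
    refine envelope_submodule_eq_top S ⟨1, by simp⟩ ?_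
    rintro x u ⟨u', hu⟩
    -- The antipode reverses products and is -1 on L, so x u goes to -u' x.
    refine ⟨-(u' * UniversalEnvelopingAlgebra.ι ℂ x), fun f w => ?_⟩
    rw [lift_toEnd_ι_mul, Module.Dual.lie_apply, hu, map_neg, map_mul, LinearMap.neg_apply,
      Module.End.mul_apply, UniversalEnvelopingAlgebra.lift_ι_apply, LieModule.toEnd_apply_apply,
      map_neg]
  have hu : u ∈ S := hS ▸ Submodule.mem_top
  exact hu

/-- A nonzero `P` separates the points of the simple module `N`, so what kills `P` already kills all
of the dual, in particular `Q`. -/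
theorem annihilator_le_of_dual [LieModule.IsIrreducible ℂ L N]
    {P Q : LieSubmodule ℂ L (Module.Dual ℂ N)} (hP : P ≠ ⊥) :
    annihilator L P ≤ annihilator L Q := by
  intro u hu
  obtain ⟨u', hu'⟩ := exists_transpose N u
  have key : ∀ (R : LieSubmodule ℂ L (Module.Dual ℂ N)) (y : R),
      ((UniversalEnvelopingAlgebra.lift ℂ (LieModule.toEnd ℂ L R) u y : R) : Module.Dual ℂ N)
        = UniversalEnvelopingAlgebra.lift ℂ (LieModule.toEnd ℂ L (Module.Dual ℂ N)) u
          (y : Module.Dual ℂ N) :=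
    fun R y => map_lift_toEnd R.incl u y
  -- The common kernel of the functionals in `P`; it is proper because `P` is nonzero.
  let K : LieSubmodule ℂ L N :=
    { carrier := {n | ∀ f ∈ P, f n = 0}
      zero_mem' := fun f _ => map_zero f
      add_mem' := fun {a b} ha hb f hf => by rw [map_add, ha f hf, hb f hf, add_zero]
      smul_mem' := fun c a ha f hf => by rw [map_smul, ha f hf, smul_zero]
      lie_mem := fun {x n} hn f hf => by
        have h := hn _ (P.lie_mem (x := x) hf)
        rwa [Module.Dual.lie_apply, neg_eq_zero] at h }
  have hK : K = ⊥ := by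
    refine (eq_bot_or_eq_top K).resolve_right fun h => hP ?_
    rw [LieSubmodule.eq_bot_iff]
    intro f hf
    ext n
    have hn : n ∈ K := h ▸ LieSubmodule.mem_top n
    exact hn f hf
  rw [mem_annihilator] at hu ⊢
  intro q
  apply Subtype.ext
  rw [key]
  ext w
  -- For f in `P`, f(u'w) = (uf)(w) = 0.
  have hw : UniversalEnvelopingAlgebra.lift ℂ (LieModule.toEnd ℂ L N) u' w ∈ K := by
    intro f hf
    have h1 := key P ⟨f, hf⟩
    rw [hu] at h1
    rw [← hu', ← h1]
    rfl
  rw [hK, LieSubmodule.mem_bot] at hw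
  rw [hu', hw, map_zero]
  rfl

/-- All nonzero submodules of the full dual of a simple module have the same annihilator. -/
theorem annihilator_eq_of_dual [LieModule.IsIrreducible ℂ L N]
    {P Q : LieSubmodule ℂ L (Module.Dual ℂ N)} (hP : P ≠ ⊥) (hQ : Q ≠ ⊥) :
    annihilator L P = annihilator L Q :=
  le_antisymm (annihilator_le_of_dual hP) (annihilator_le_of_dual hQ)

end Envelope

/-- Irreducibility passes to the image of a surjection that is semilinear with respect to a
surjective map of `L`. -/
theorem isIrreducible_of_surjective_twisted {L M N : Type*} [LieRing L] [AddCommGroup M]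
    [Module ℂ M] [LieRingModule L M] [AddCommGroup N] [Module ℂ N] [LieRingModule L N]
    [LieModule.IsIrreducible ℂ L M] [Nontrivial N] (θ : L → L) (f : M →ₗ[ℂ] N)
    (hf : Function.Surjective f)
    (hlie : ∀ x m, f ⁅x, m⁆ = ⁅θ x, f m⁆) : LieModule.IsIrreducible ℂ L N := by
  refine LieModule.IsIrreducible.mk fun P hP => ?_
  let K : LieSubmodule ℂ L M :=
    { P.toSubmodule.comap f with
      lie_mem := fun {x m} hm => by
        change f ⁅x, m⁆ ∈ P
        rw [hlie]
        exact P.lie_mem hm }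
  have hK : K = ⊤ := by
    refine (eq_bot_or_eq_top K).resolve_left fun h => hP ?_
    rw [LieSubmodule.eq_bot_iff]
    intro n hn
    obtain ⟨m, rfl⟩ := hf n
    have hm : m ∈ K := hn
    rw [h, LieSubmodule.mem_bot] at hm
    rw [hm, map_zero]
  rw [eq_top_iff]
  intro n _
  obtain ⟨m, rfl⟩ := hf n
  have hm : m ∈ K := hK ▸ LieSubmodule.mem_top m
  exact hm

/-! ### Generators of induced modules -/

namespace Induced

variable {g : Type*} [LieRing g] [LieAlgebra ℂ g] {V : Type*} [AddCommGroup V] [Module ℂ V]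
  (s : LieSubalgebra ℂ g) (φ : s →ₗ⁅ℂ⁆ Module.End ℂ V)

theorem lie_def (x : g) (m : Induced s φ) : ⁅x, m⁆ = UniversalEnvelopingAlgebra.ι ℂ x • m := rfl

theorem smul_tmul (a u : UniversalEnvelopingAlgebra ℂ g) (v : V) :
    a • tmul s φ u v = tmul s φ (a * u) v := rfl

theorem tmul_smul (u : UniversalEnvelopingAlgebra ℂ g) (c : ℂ) (v : V) :
    tmul s φ u (c • v) = c • tmul s φ u v := by
  change (balancing s φ).mkQ (u ⊗ₜ[ℂ] (c • v)) = _
  rw [TensorProduct.tmul_smul, ← algebraMap_smul (UniversalEnvelopingAlgebra ℂ g), map_smul,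
    algebraMap_smul]
  rfl

theorem lie_tmul_one (a : s) (v : V) : ⁅(a : g), tmul s φ 1 v⁆ = tmul s φ 1 (φ a v) := by
  rw [lie_def, smul_tmul, mul_one]
  refine (Submodule.Quotient.eq _).2 (Submodule.subset_span
    ⟨1, UniversalEnvelopingAlgebra.ι ℂ a, v, ?_⟩)
  rw [one_mul, envIncl, UniversalEnvelopingAlgebra.lift_ι_apply,
    UniversalEnvelopingAlgebra.lift_ι_apply]
  rfl

theorem submodule_eq_top (P : Submodule ℂ (Induced s φ)) (hP : ∀ v, tmul s φ 1 v ∈ P)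
    (hlie : ∀ (x : g), ∀ m ∈ P, ⁅x, m⁆ ∈ P) : P = ⊤ := by
  let S : Submodule ℂ (UniversalEnvelopingAlgebra ℂ g) :=
    { carrier := {u | ∀ m ∈ P, u • m ∈ P}
      zero_mem' := fun m _ => by rw [zero_smul]; exact P.zero_mem
      add_mem' := fun {a b} ha hb m hm => by rw [add_smul]; exact P.add_mem (ha m hm) (hb m hm)
      smul_mem' := fun c a ha m hm => by rw [smul_assoc]; exact P.smul_mem c (ha m hm) }
  have hS : S = ⊤ := by
    refine envelope_submodule_eq_top S (fun m hm => by rwa [one_smul]) fun x u hu m hm => ?_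
    rw [mul_smul]
    exact hlie x _ (hu m hm)
  rw [eq_top_iff]
  intro m _
  obtain ⟨t, rfl⟩ := (balancing s φ).mkQ_surjective m
  induction t with
  | zero => rw [map_zero]; exact P.zero_mem
  | tmul u v =>
    have hu : u ∈ S := hS ▸ Submodule.mem_top
    have h := hu _ (hP v)
    rw [smul_tmul, mul_one] at h
    exact h
  | add a b ha hb => rw [map_add]; exact P.add_mem (ha trivial) (hb trivial)

section Character

variable (χ : LieAlgebra.LieCharacter ℂ s)

theorem lie_tmul_one_one (a : s) :
    ⁅(a : g), tmul s (charRep χ) 1 1⁆ = χ a • tmul s (charRep χ) 1 1 := by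
  rw [lie_tmul_one]
  exact tmul_smul s (charRep χ) 1 (χ a) 1

theorem submodule_eq_top_of_generator (P : Submodule ℂ (Induced s (charRep χ)))
    (hP : tmul s (charRep χ) 1 1 ∈ P) (hlie : ∀ (x : g), ∀ m ∈ P, ⁅x, m⁆ ∈ P) : P = ⊤ := by
  refine submodule_eq_top s _ P (fun v => ?_) hlie
  have h : tmul s (charRep χ) 1 v = v • tmul s (charRep χ) 1 1 := by
    rw [← tmul_smul, smul_eq_mul, mul_one]
  rw [h]
  exact P.smul_mem v hP

end Character

end Induced

/-! ### Modules induced from b for g = p ⊕ b, realized on U(p) -/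

section Complement

variable {g : Type*} [LieRing g] [LieAlgebra ℂ g] (p b : LieSubalgebra ℂ g)
  (hpb : IsCompl p.toSubmodule b.toSubmodule) (χ : LieAlgebra.LieCharacter ℂ b)

/-- The action of `p` on the linear maps `g → U(p)`, where `p` acts on `g` by the adjoint action
and on `U(p)` by left multiplication. -/
def homEnvelopeRep : p →ₗ⁅ℂ⁆ Module.End ℂ (g →ₗ[ℂ] UniversalEnvelopingAlgebra ℂ p) where
  toFun x :=
    { toFun := fun F => LinearMap.mulLeft ℂ (UniversalEnvelopingAlgebra.ι ℂ x) ∘ₗ F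
        - F ∘ₗ (LieAlgebra.ad ℂ g (x : g) : g →ₗ[ℂ] g)
      map_add' := fun F G => by
        ext c
        simp [mul_add]
        abel
      map_smul' := fun t F => by
        ext c
        simp [smul_sub] }
  map_add' x y := by
    ext F c
    simp [add_mul]
    abel
  map_smul' t x := by
    ext F c
    simp [smul_sub]
  map_lie' {x y} := by
    ext F c
    simp [LieRing.of_associative_ring_bracket, mul_sub, sub_mul, mul_assoc]
    abel

theorem homEnvelopeRep_apply (x : p) (F : g →ₗ[ℂ] UniversalEnvelopingAlgebra ℂ p) (c : g) :
    homEnvelopeRep p x F c = UniversalEnvelopingAlgebra.ι ℂ x * F c - F ⁅(x : g), c⁆ := rfl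

/-- The linear map `g → U(p)` that gives the action of `g = p ⊕ b` on the generator of the module
induced from the character `χ` of `b`. -/
def generatorAction : g →ₗ[ℂ] UniversalEnvelopingAlgebra ℂ p :=
  (UniversalEnvelopingAlgebra.ι ℂ : p →ₗ⁅ℂ⁆ UniversalEnvelopingAlgebra ℂ p).toLinearMap ∘ₗ
      Submodule.projectionOnto _ _ hpb
    + (Algebra.linearMap ℂ (UniversalEnvelopingAlgebra ℂ p)) ∘ₗ χ.toLinearMap ∘ₗ
      Submodule.projectionOnto _ _ hpb.symm

theorem generatorAction_left (x : p) :
    generatorAction p b hpb χ (x : g) = UniversalEnvelopingAlgebra.ι ℂ x := by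
  have h1 : Submodule.projectionOnto _ _ hpb (x : g) = x :=
    Submodule.projectionOnto_apply_left hpb x
  have h2 : Submodule.projectionOnto _ _ hpb.symm (x : g) = 0 :=
    Submodule.projectionOnto_apply_right hpb.symm x
  simp only [generatorAction, LinearMap.add_apply, LinearMap.comp_apply]
  rw [h1, h2]
  simp

theorem generatorAction_right (x : b) :
    generatorAction p b hpb χ (x : g) = algebraMap ℂ (UniversalEnvelopingAlgebra ℂ p) (χ x) := by
  have h1 : Submodule.projectionOnto _ _ hpb (x : g) = 0 :=
    Submodule.projectionOnto_apply_right hpb x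
  have h2 : Submodule.projectionOnto _ _ hpb.symm (x : g) = x :=
    Submodule.projectionOnto_apply_left hpb.symm x
  simp only [generatorAction, LinearMap.add_apply, LinearMap.comp_apply]
  rw [h1, h2]
  simp

/-- The operators on `U(p)` by which `g = p ⊕ b` acts on the module induced from the character `χ`
of `b`, when this module is identified with `U(p)`. -/
def envelopeAction : g →ₗ[ℂ] Module.End ℂ (UniversalEnvelopingAlgebra ℂ p) :=
  -- On a module with generator v, the maps F_u : c ↦ c u v satisfy F_{xu}(c) = x F_u(c) - F_u([x,
  -- c]) for x in p, which is `homEnvelopeRep`. So F_u must be u applied to F_1, and F_1 is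
  -- `generatorAction`.
  LinearMap.flip (LinearMap.applyₗ (generatorAction p b hpb χ) ∘ₗ
    (UniversalEnvelopingAlgebra.lift ℂ (homEnvelopeRep p)).toLinearMap)

theorem envelopeAction_one (c : g) :
    envelopeAction p b hpb χ c 1 = generatorAction p b hpb χ c := by
  simp [envelopeAction]

/-- The commutation rule c x = x c + [c, x]. Together with the value at 1 it determines the
operators, and it drives the inductions over U(p) below. -/
theorem envelopeAction_ι_mul (c : g) (x : p) (u : UniversalEnvelopingAlgebra ℂ p) :
    envelopeAction p b hpb χ c (UniversalEnvelopingAlgebra.ι ℂ x * u)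
      = UniversalEnvelopingAlgebra.ι ℂ x * envelopeAction p b hpb χ c u
        + envelopeAction p b hpb χ ⁅c, (x : g)⁆ u := by
  have h : envelopeAction p b hpb χ c (UniversalEnvelopingAlgebra.ι ℂ x * u)
      = UniversalEnvelopingAlgebra.ι ℂ x * envelopeAction p b hpb χ c u
        - envelopeAction p b hpb χ ⁅(x : g), c⁆ u := by
    simp [envelopeAction, homEnvelopeRep_apply]
  rw [h, ← lie_skew c (x : g), map_neg, LinearMap.neg_apply, sub_eq_add_neg]

theorem envelopeAction_left (x : p) (u : UniversalEnvelopingAlgebra ℂ p) :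
    envelopeAction p b hpb χ (x : g) u = UniversalEnvelopingAlgebra.ι ℂ x * u := by
  -- The quantifier over x stays inside, since the step from u to y u uses the claim for [x, y].
  let S : Submodule ℂ (UniversalEnvelopingAlgebra ℂ p) :=
    { carrier := {u | ∀ x : p, envelopeAction p b hpb χ (x : g) u
        = UniversalEnvelopingAlgebra.ι ℂ x * u}
      zero_mem' := fun x => by simp
      add_mem' := fun {v w} hv hw x => by rw [map_add, hv, hw, mul_add]
      smul_mem' := fun c v hv x => by rw [map_smul, hv, mul_smul_comm] }
  have hS : S = ⊤ := by
    refine envelope_submodule_eq_top S (fun x => ?_) fun y u hu x => ?_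
    · rw [envelopeAction_one, generatorAction_left, mul_one]
    · have h := hu ⁅x, y⁆
      rw [LieSubalgebra.coe_bracket] at h
      rw [envelopeAction_ι_mul, hu x, h, LieHom.map_lie, LieRing.of_associative_ring_bracket,
        sub_mul, mul_assoc, mul_assoc]
      abel
  have hu : u ∈ S := hS ▸ Submodule.mem_top
  exact hu x

/-- Splitting c and d along p ⊕ b leaves two cases. If one argument lies in p, the identity is the
commutation rule; if both lie in b, they act on the scalars in U(p) through `χ`, which vanishes on
brackets. -/
theorem envelopeAction_lie_one (c d : g) :
    envelopeAction p b hpb χ ⁅c, d⁆ 1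
      = envelopeAction p b hpb χ c (envelopeAction p b hpb χ d 1)
        - envelopeAction p b hpb χ d (envelopeAction p b hpb χ c 1) := by
  have left : ∀ (c : g) (x : p), envelopeAction p b hpb χ ⁅c, (x : g)⁆ 1
      = envelopeAction p b hpb χ c (envelopeAction p b hpb χ (x : g) 1)
        - envelopeAction p b hpb χ (x : g) (envelopeAction p b hpb χ c 1) := by
    intro c x
    rw [envelopeAction_left, envelopeAction_left, envelopeAction_ι_mul]
    abel
  have right : ∀ y z : b, envelopeAction p b hpb χ ⁅(y : g), (z : g)⁆ 1
      = envelopeAction p b hpb χ (y : g) (envelopeAction p b hpb χ (z : g) 1)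
        - envelopeAction p b hpb χ (z : g) (envelopeAction p b hpb χ (y : g) 1) := by
    intro y z
    have h : ∀ (y : b) (t : ℂ),
        envelopeAction p b hpb χ (y : g) (algebraMap ℂ (UniversalEnvelopingAlgebra ℂ p) t)
          = algebraMap ℂ (UniversalEnvelopingAlgebra ℂ p) (t * χ y) := by
      intro y t
      rw [Algebra.algebraMap_eq_smul_one, map_smul, envelopeAction_one, generatorAction_right,
        Algebra.smul_def, ← map_mul]
    rw [← LieSubalgebra.coe_bracket]
    simp only [envelopeAction_one, generatorAction_right]
    rw [h, h, LieAlgebra.lieCharacter_apply_lie, map_zero, mul_comm, sub_self]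
  have hc : c ∈ p.toSubmodule ⊔ b.toSubmodule := hpb.sup_eq_top ▸ Submodule.mem_top
  have hd : d ∈ p.toSubmodule ⊔ b.toSubmodule := hpb.sup_eq_top ▸ Submodule.mem_top
  obtain ⟨x, hx, y, hy, rfl⟩ := Submodule.mem_sup.1 hc
  obtain ⟨x', hx', z, hz, rfl⟩ := Submodule.mem_sup.1 hd
  have h1 := left (x + y) ⟨x', hx'⟩
  have h2 := left z ⟨x, hx⟩
  have h3 := right ⟨y, hy⟩ ⟨z, hz⟩
  rw [← lie_skew] at h2
  simp only [add_lie, lie_add, map_add, LinearMap.add_apply, map_neg, LinearMap.neg_apply]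
    at h1 h2 h3 ⊢
  rw [neg_eq_iff_eq_neg] at h2
  rw [h2, h3, h1]
  abel

/-- Induction on u: passing from u to x u by the commutation rule leaves exactly the Jacobi identity
for c, d, x. -/
theorem envelopeAction_lie (c d : g) (u : UniversalEnvelopingAlgebra ℂ p) :
    envelopeAction p b hpb χ ⁅c, d⁆ u
      = envelopeAction p b hpb χ c (envelopeAction p b hpb χ d u)
        - envelopeAction p b hpb χ d (envelopeAction p b hpb χ c u) := by
  let S : Submodule ℂ (UniversalEnvelopingAlgebra ℂ p) :=
    { carrier := {u | ∀ c d : g, envelopeAction p b hpb χ ⁅c, d⁆ u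
        = envelopeAction p b hpb χ c (envelopeAction p b hpb χ d u)
          - envelopeAction p b hpb χ d (envelopeAction p b hpb χ c u)}
      zero_mem' := fun c d => by simp
      add_mem' := fun {v w} hv hw c d => by
        simp only [map_add, hv c d, hw c d]
        abel
      smul_mem' := fun t v hv c d => by simp only [map_smul, hv c d, smul_sub] }
  have hS : S = ⊤ := by
    refine envelope_submodule_eq_top S (envelopeAction_lie_one p b hpb χ) fun x u hu c d => ?_
    simp only [envelopeAction_ι_mul, map_add]
    rw [lie_lie, map_sub, LinearMap.sub_apply, hu c d, hu c ⁅d, (x : g)⁆, hu d ⁅c, (x : g)⁆,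
      mul_sub]
    abel
  have hu : u ∈ S := hS ▸ Submodule.mem_top
  exact hu c d

/-- The representation of `g = p ⊕ b` on `U(p)` that extends left multiplication and for which
`b` acts on `1` through the character `χ`. -/
def envelopeRep : g →ₗ⁅ℂ⁆ Module.End ℂ (UniversalEnvelopingAlgebra ℂ p) where
  toLinearMap := envelopeAction p b hpb χ
  map_lie' {c d} := LinearMap.ext (envelopeAction_lie p b hpb χ c d)

/-- If `g = p ⊕ b`, every character of `p` extends to a functional on the module induced from a
character of `b` that is normalized on the generator. -/
theorem exists_whittaker_functional (hpb : IsCompl p.toSubmodule b.toSubmodule)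
    (ψ : LieAlgebra.LieCharacter ℂ p) :
    ∃ f ∈ whittakerVectors p ψ (Module.Dual ℂ (Induced b (charRep χ))),
      f (Induced.tmul b (charRep χ) 1 1) = 1 := by
  let i1 : LieRingModule g (UniversalEnvelopingAlgebra ℂ p) :=
    LieRingModule.compLieHom _ (envelopeRep p b hpb χ)
  have i2 : LieModule ℂ g (UniversalEnvelopingAlgebra ℂ p) :=
    LieModule.compLieHom _ (envelopeRep p b hpb χ)
  have hlie : ∀ (c : g) (u : UniversalEnvelopingAlgebra ℂ p),
      ⁅c, u⁆ = envelopeAction p b hpb χ c u := fun c u => rfl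
  let w : whittakerVectors b χ (UniversalEnvelopingAlgebra ℂ p) := ⟨1, fun y => by
    rw [hlie, envelopeAction_one, generatorAction_right, Algebra.algebraMap_eq_smul_one]⟩
  -- The sign compensates for the one in the action on the dual.
  let ψ' : LieAlgebra.LieCharacter ℂ p :=
    { toLinearMap := -ψ.toLinearMap
      map_lie' := fun {x y} => by
        change -ψ ⁅x, y⁆ = ⁅-ψ x, -ψ y⁆
        rw [LieAlgebra.lieCharacter_apply_lie, neg_zero, LieRing.of_associative_ring_bracket,
          mul_comm, sub_self] }
  let F : UniversalEnvelopingAlgebra ℂ p →ₐ[ℂ] ℂ := UniversalEnvelopingAlgebra.lift ℂ ψ'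
  refine ⟨F.toLinearMap ∘ₗ (whittakerHom w : Induced b (charRep χ) →ₗ[ℂ] _), fun x => ?_, ?_⟩
  · ext m
    change -(F (whittakerHom w ⁅(x : g), m⁆)) = ψ x * F (whittakerHom w m)
    rw [LieModuleHom.map_lie, hlie, envelopeAction_left, map_mul,
      UniversalEnvelopingAlgebra.lift_ι_apply, ← neg_mul]
    change -(-ψ x) * _ = _
    rw [neg_neg]
  · change F (whittakerHom w (standardGenerator b χ)) = 1
    rw [whittakerHom_generator]
    exact map_one F

/-- The generator v of the induced module already generates it over U(p), and such a functional is
determined along U(p)v by its value at v. -/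
theorem whittaker_functional_ext (hsup : p.toSubmodule ⊔ b.toSubmodule = ⊤)
    (ψ : LieAlgebra.LieCharacter ℂ p) {f₁ f₂ : Module.Dual ℂ (Induced b (charRep χ))}
    (h₁ : f₁ ∈ whittakerVectors p ψ (Module.Dual ℂ (Induced b (charRep χ))))
    (h₂ : f₂ ∈ whittakerVectors p ψ (Module.Dual ℂ (Induced b (charRep χ))))
    (h : f₁ (Induced.tmul b (charRep χ) 1 1) = f₂ (Induced.tmul b (charRep χ) 1 1)) :
    f₁ = f₂ := by
  set v := Induced.tmul b (charRep χ) 1 1 with hv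
  let act : UniversalEnvelopingAlgebra ℂ p →ₗ[ℂ] Induced b (charRep χ) :=
    { toFun := fun u => envIncl p u • v
      map_add' := fun a c => by rw [map_add, add_smul]
      map_smul' := fun c a => by rw [map_smul, smul_assoc]; rfl }
  have act_mul : ∀ (x : p) (u : UniversalEnvelopingAlgebra ℂ p),
      act (UniversalEnvelopingAlgebra.ι ℂ x * u) = ⁅(x : g), act u⁆ := by
    intro x u
    change envIncl p (UniversalEnvelopingAlgebra.ι ℂ x * u) • v = _
    rw [map_mul, mul_smul, envIncl, UniversalEnvelopingAlgebra.lift_ι_apply]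
    rfl
  have act_one : act 1 = v := by
    change envIncl p 1 • v = v
    rw [map_one, one_smul]
  -- U(p)v contains v and is g-stable: g v lies in pv + ℂv, and c x u v = [c, x] u v + x c u v
  -- carries stability from u to x u.
  have hrange : LinearMap.range act = ⊤ := by
    refine Induced.submodule_eq_top_of_generator b χ _ ⟨1, act_one⟩ ?_
    rintro c _ ⟨u, rfl⟩
    let S : Submodule ℂ (UniversalEnvelopingAlgebra ℂ p) :=
      { carrier := {u | ∀ c : g, ⁅c, act u⁆ ∈ LinearMap.range act}
        zero_mem' := fun c => by
          rw [map_zero, lie_zero]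
          exact Submodule.zero_mem _
        add_mem' := fun {a e} ha he c => by
          rw [map_add, lie_add]
          exact Submodule.add_mem _ (ha c) (he c)
        smul_mem' := fun t a ha c => by
          rw [map_smul, lie_smul]
          exact Submodule.smul_mem _ t (ha c) }
    have hS : S = ⊤ := by
      refine envelope_submodule_eq_top S (fun c => ?_) fun x u hu c => ?_
      · have hc : c ∈ p.toSubmodule ⊔ b.toSubmodule := hsup ▸ Submodule.mem_top
        obtain ⟨x, hx, y, hy, rfl⟩ := Submodule.mem_sup.1 hc
        rw [add_lie]
        refine Submodule.add_mem _ ⟨_, act_mul ⟨x, hx⟩ 1⟩ ?_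
        rw [act_one, Induced.lie_tmul_one_one b χ ⟨y, hy⟩]
        exact Submodule.smul_mem _ _ ⟨1, act_one⟩
      · rw [act_mul, leibniz_lie]
        refine Submodule.add_mem _ (hu _) ?_
        obtain ⟨u', hu'⟩ := hu c
        rw [← hu']
        exact ⟨_, act_mul x u'⟩
    have hu : u ∈ S := hS ▸ Submodule.mem_top
    exact hu c
  have hlie : ∀ {f : Module.Dual ℂ (Induced b (charRep χ))},
      f ∈ whittakerVectors p ψ (Module.Dual ℂ (Induced b (charRep χ))) →
      ∀ (x : p) (m : Induced b (charRep χ)), f ⁅(x : g), m⁆ = -(ψ x * f m) := by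
    intro f hf x m
    have h := DFunLike.congr_fun (hf x) m
    rw [Module.Dual.lie_apply] at h
    rw [neg_eq_iff_eq_neg.1 h]
    rfl
  have heq : LinearMap.ker ((f₁ - f₂) ∘ₗ act) = ⊤ := by
    refine envelope_submodule_eq_top _ ?_ fun x u hu => ?_
    · rw [LinearMap.mem_ker, LinearMap.comp_apply, act_one, LinearMap.sub_apply, h, sub_self]
    · rw [LinearMap.mem_ker, LinearMap.comp_apply, LinearMap.sub_apply, sub_eq_zero] at hu ⊢
      rw [act_mul, hlie h₁, hlie h₂, hu]
  ext m
  obtain ⟨u, rfl⟩ : m ∈ LinearMap.range act := hrange ▸ Submodule.mem_top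
  have hu : u ∈ LinearMap.ker ((f₁ - f₂) ∘ₗ act) := heq ▸ Submodule.mem_top
  rw [LinearMap.mem_ker, LinearMap.comp_apply, LinearMap.sub_apply, sub_eq_zero] at hu
  exact hu

end Complement

/-! ### Twisting a module by an endomorphism of g -/

section Twist

variable {g : Type*} [LieRing g] [LieAlgebra ℂ g]

/-- The module obtained from `M` by letting `g` act through an endomorphism `θ` of `g`. -/
def Twist (_ : g →ₗ⁅ℂ⁆ g) (M : Type*) : Type _ := M

variable (θ : g →ₗ⁅ℂ⁆ g) (M : Type*) [AddCommGroup M] [Module ℂ M] [LieRingModule g M]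

instance : AddCommGroup (Twist θ M) := inferInstanceAs (AddCommGroup M)

instance : Module ℂ (Twist θ M) := inferInstanceAs (Module ℂ M)

instance : LieRingModule g (Twist θ M) := LieRingModule.compLieHom M θ

instance [LieModule ℂ g M] : LieModule ℂ g (Twist θ M) := LieModule.compLieHom M θ

/-- The identity map from the twisted module to the module itself. -/
def untwist : Twist θ M ≃ₗ[ℂ] M := LinearEquiv.refl ℂ M

theorem untwist_lie (x : g) (m : Twist θ M) : untwist θ M ⁅x, m⁆ = ⁅θ x, untwist θ M m⁆ := rfl

end Twist

/-! ### Verma modules and their duals -/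

namespace TriangularDecomposition

variable {g : Type*} [LieRing g] [LieAlgebra ℂ g] (T : TriangularDecomposition g)

theorem proj_eq_zero {x : g} (hx : x ∈ T.neg.toSubmodule ⊔ T.pos.toSubmodule) : T.proj x = 0 :=
  (Submodule.projectionOnto_apply_eq_zero_iff T.isCompl_cartan).2 hx

theorem isCompl_pos_borel :
    IsCompl T.pos.toSubmodule (T.borel T.neg T.cartan_lie_neg).toSubmodule := by
  have h := (DirectSum.isInternal_submodule_iff_iSupIndep_and_iSup_eq_top _).1 T.isInternal
  have h1 : (⨆ j, ⨆ (_ : j ≠ (2 : Fin 3)),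
      (![T.neg.toSubmodule, T.cartan.toSubmodule, T.pos.toSubmodule] j))
      = T.cartan.toSubmodule ⊔ T.neg.toSubmodule := by
    apply le_antisymm
    · refine iSup₂_le fun j hj => ?_
      fin_cases j
      · exact le_sup_right
      · exact le_sup_left
      · exact absurd rfl hj
    · exact sup_le (le_iSup₂_of_le (1 : Fin 3) (by decide) le_rfl)
        (le_iSup₂_of_le (0 : Fin 3) (by decide) le_rfl)
  refine ⟨?_, codisjoint_iff_le_sup.2 ?_⟩
  · have h2 := h.1 2
    rw [h1] at h2
    exact h2
  · rw [← h.2]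
    refine iSup_le fun j => ?_
    fin_cases j
    · exact le_sup_right.trans le_sup_right
    · exact le_sup_left.trans le_sup_right
    · exact le_sup_left

variable {T} in
theorem borelChar_apply_add {n : LieSubalgebra ℂ g} (hn : ∀ x ∈ T.cartan, ∀ y ∈ n, ⁅x, y⁆ ∈ n)
    (hle : n.toSubmodule ≤ T.neg.toSubmodule ⊔ T.pos.toSubmodule) (ν : Module.Dual ℂ T.cartan)
    (x : T.cartan) {y : g} (hy : y ∈ n) (h : (x : g) + y ∈ T.borel n hn) :
    T.borelChar n hn hle ν ⟨(x : g) + y, h⟩ = ν x := by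
  change ν (T.proj ((x : g) + y)) = ν x
  rw [map_add, T.proj_cartan, T.proj_eq_zero (hle hy), add_zero]

/-- The generator of a lowest weight Verma module. -/
abbrev lowestVector (ν : Module.Dual ℂ T.cartan) : T.LowestVerma ν := Induced.tmul _ _ 1 1

theorem cartan_lie_lowestVector (ν : Module.Dual ℂ T.cartan) (x : T.cartan) :
    ⁅(x : g), T.lowestVector ν⁆ = ν x • T.lowestVector ν := by
  have hx : (x : g) + 0 ∈ T.borel T.neg T.cartan_lie_neg :=
    Submodule.add_mem_sup x.2 T.neg.zero_mem
  have h := Induced.lie_tmul_one_one _ (T.borelChar T.neg T.cartan_lie_neg le_sup_left ν) ⟨_, hx⟩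
  rw [borelChar_apply_add _ _ _ _ T.neg.zero_mem] at h
  simpa only [add_zero] using h

theorem neg_lie_lowestVector (ν : Module.Dual ℂ T.cartan) {y : g} (hy : y ∈ T.neg) :
    ⁅y, T.lowestVector ν⁆ = 0 := by
  have hx : ((0 : T.cartan) : g) + y ∈ T.borel T.neg T.cartan_lie_neg :=
    Submodule.add_mem_sup (0 : T.cartan).2 hy
  have h := Induced.lie_tmul_one_one _ (T.borelChar T.neg T.cartan_lie_neg le_sup_left ν) ⟨_, hx⟩
  rw [borelChar_apply_add _ _ _ _ hy, map_zero, zero_smul] at h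
  simpa only [ZeroMemClass.coe_zero, zero_add] using h

theorem sigma_mem_neg {x : g} (hx : x ∈ T.pos) : T.sigma x ∈ T.neg := by
  have h : T.sigma x ∈ T.pos.toSubmodule.map T.sigma := ⟨x, hx, rfl⟩
  rw [T.map_sigma] at h
  exact h

/-- The involution `-σ` of the Lie algebra `g`. -/
def chevalley : g →ₗ⁅ℂ⁆ g where
  toLinearMap := -T.sigma
  map_lie' {x y} := by
    change -T.sigma ⁅x, y⁆ = ⁅-T.sigma x, -T.sigma y⁆
    rw [T.sigma_lie, neg_lie, lie_neg, neg_neg, lie_skew]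

theorem chevalley_apply (x : g) : T.chevalley x = -T.sigma x := rfl

theorem chevalley_chevalley (x : g) : T.chevalley (T.chevalley x) = x := by
  rw [chevalley_apply, chevalley_apply, map_neg, neg_neg, T.sigma_sigma]

section Simple

variable (μ : Module.Dual ℂ T.cartan)

/-- Because -σ is -1 on h and sends n₊ to n₋, a lowest weight vector of weight -μ becomes a highest
weight vector of weight μ. This is what the universal property of M(μ) needs in order to give a map
to the twist of N(-μ). -/
theorem lowestVector_mem_whittakerVectors_twist :
    (untwist T.chevalley _).symm (T.lowestVector (-μ)) ∈ whittakerVectors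
      (T.borel T.pos T.cartan_lie_pos) (T.borelChar T.pos T.cartan_lie_pos le_sup_right μ)
      (Twist T.chevalley (T.LowestVerma (-μ))) := by
  rintro ⟨x, hx⟩
  obtain ⟨a, ha, c, hc, rfl⟩ := Submodule.mem_sup.1 hx
  rw [borelChar_apply_add T.cartan_lie_pos le_sup_right μ ⟨a, ha⟩ hc]
  change ⁅T.chevalley (a + c), T.lowestVector (-μ)⁆ = μ ⟨a, ha⟩ • T.lowestVector (-μ)
  rw [chevalley_apply, map_add, T.sigma_cartan a ha, neg_lie, add_lie,
    T.neg_lie_lowestVector _ (T.sigma_mem_neg hc), add_zero,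
    T.cartan_lie_lowestVector (-μ) ⟨a, ha⟩, LinearMap.neg_apply, neg_smul, neg_neg]

/-- A Whittaker functional takes the value 1 on it; the zero character suffices. -/
theorem lowestVector_ne_zero : T.lowestVector μ ≠ 0 := by
  obtain ⟨f, -, hf⟩ := exists_whittaker_functional T.pos _
    (T.borelChar T.neg T.cartan_lie_neg le_sup_left μ) T.isCompl_pos_borel 0
  intro h
  rw [show Induced.tmul _ _ 1 1 = T.lowestVector μ from rfl, h, map_zero] at hf
  exact zero_ne_one hf

theorem isIrreducible_lowestVerma [LieModule.IsIrreducible ℂ g (T.Verma μ)] :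
    LieModule.IsIrreducible ℂ g (T.LowestVerma (-μ)) := by
  have : Nontrivial (T.LowestVerma (-μ)) := ⟨_, _, T.lowestVector_ne_zero (-μ)⟩
  let F := whittakerHom ⟨_, T.lowestVector_mem_whittakerVectors_twist μ⟩
  let f : T.Verma μ →ₗ[ℂ] T.LowestVerma (-μ) :=
    (untwist T.chevalley (T.LowestVerma (-μ))).toLinearMap ∘ₗ (F : T.Verma μ →ₗ[ℂ] _)
  have hlie : ∀ x m, f ⁅x, m⁆ = ⁅T.chevalley x, f m⁆ := by
    intro x m
    change untwist T.chevalley _ (F ⁅x, m⁆) = _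
    rw [LieModuleHom.map_lie, untwist_lie]
    rfl
  refine isIrreducible_of_surjective_twisted T.chevalley f ?_ hlie
  rw [← LinearMap.range_eq_top]
  refine Induced.submodule_eq_top_of_generator _ _ _
    ⟨standardGenerator _ _, whittakerHom_generator ⟨_, T.lowestVector_mem_whittakerVectors_twist μ⟩⟩
    ?_
  rintro x _ ⟨m, rfl⟩
  -- As -σ is an involution, the range of a map semilinear for it is stable under all of g.
  refine ⟨⁅T.chevalley x, m⁆, ?_⟩
  rw [hlie, chevalley_chevalley]

end Simple

variable (μ : Module.Dual ℂ T.cartan) (χ : LieAlgebra.LieCharacter ℂ T.pos)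

theorem exists_whittakerVector : ∃ f ∈ whittakerVectors T.pos χ (T.DualLowestVerma μ),
    f (T.lowestVector (-μ)) = 1 :=
  exists_whittaker_functional T.pos _ _ T.isCompl_pos_borel χ

variable {T μ χ} in
theorem whittakerVector_ext {f₁ f₂ : T.DualLowestVerma μ}
    (h₁ : f₁ ∈ whittakerVectors T.pos χ (T.DualLowestVerma μ))
    (h₂ : f₂ ∈ whittakerVectors T.pos χ (T.DualLowestVerma μ))
    (h : f₁ (T.lowestVector (-μ)) = f₂ (T.lowestVector (-μ))) : f₁ = f₂ :=
  whittaker_functional_ext T.pos _ _ T.isCompl_pos_borel.sup_eq_top χ h₁ h₂ h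

theorem finrank_whittakerVectors :
    Module.finrank ℂ (whittakerVectors T.pos χ (T.DualLowestVerma μ)) = 1 := by
  obtain ⟨f, hf, hf1⟩ := T.exists_whittakerVector μ χ
  refine (finrank_eq_one_iff_of_nonzero' (⟨f, hf⟩ : whittakerVectors T.pos χ _) ?_).2 ?_
  · intro h
    have h0 : f = 0 := congrArg Subtype.val h
    rw [h0, LinearMap.zero_apply] at hf1
    exact zero_ne_one hf1
  · rintro ⟨k, hk⟩
    refine ⟨k (T.lowestVector (-μ)), Subtype.ext ?_⟩
    refine whittakerVector_ext (Submodule.smul_mem _ _ hf) hk ?_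
    change k (T.lowestVector (-μ)) * f (T.lowestVector (-μ)) = k (T.lowestVector (-μ))
    rw [hf1, mul_one]

/-- A functional on `N(-μ)` annihilated by `n₊` has weight `μ`. -/
theorem mem_whittakerVectors_borel {f : T.DualLowestVerma μ}
    (hf : f ∈ whittakerVectors T.pos 0 (T.DualLowestVerma μ)) :
    f ∈ whittakerVectors (T.borel T.pos T.cartan_lie_pos)
      (T.borelChar T.pos T.cartan_lie_pos le_sup_right μ) (T.DualLowestVerma μ) := by
  have hpos : ∀ {k : T.DualLowestVerma μ}, k ∈ whittakerVectors T.pos 0 (T.DualLowestVerma μ) →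
      ∀ c ∈ T.pos, ⁅c, k⁆ = 0 := fun {k} hk c hc => by
    rw [hk ⟨c, hc⟩]
    exact zero_smul ℂ k
  rintro ⟨x, hx⟩
  obtain ⟨a, ha, c, hc, rfl⟩ := Submodule.mem_sup.1 hx
  rw [borelChar_apply_add T.cartan_lie_pos le_sup_right μ ⟨a, ha⟩ hc]
  change ⁅a + c, f⁆ = _
  rw [add_lie, hpos hf c hc, add_zero]
  -- Since h normalizes n₊, af is again killed by n₊, so it suffices to compare af and μ(a)f at the
  -- lowest weight vector; there the sign of the dual action cancels that of -μ.
  refine whittakerVector_ext (χ := 0) ?_ (Submodule.smul_mem _ _ hf) ?_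
  · rintro ⟨y, hy⟩
    change ⁅y, ⁅a, f⁆⁆ = (0 : ℂ) • ⁅a, f⁆
    rw [leibniz_lie, hpos hf y hy, lie_zero, add_zero, zero_smul, ← lie_skew, neg_lie,
      hpos hf _ (T.cartan_lie_pos a ha y hy), neg_zero]
  · rw [Module.Dual.lie_apply, T.cartan_lie_lowestVector (-μ) ⟨a, ha⟩, map_smul,
      LinearMap.smul_apply, LinearMap.neg_apply, neg_smul, neg_neg]

variable {T μ} in
theorem whittakerImage_ne_bot {χ : LieAlgebra.LieCharacter ℂ T.pos}
    {w : whittakerVectors T.pos χ (T.DualLowestVerma μ)} (hw : w ≠ 0) :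
    T.whittakerImage μ χ w ≠ ⊥ := by
  intro h
  have hmem : (w : T.DualLowestVerma μ) ∈ T.whittakerImage μ χ w :=
    (LieModuleHom.mem_range _ _).2 ⟨_, whittakerHom_generator w⟩
  rw [h, LieSubmodule.mem_bot] at hmem
  exact hw (Subtype.ext hmem)

/-- The nonzero functional killed by n₊ is a highest weight vector of weight μ; the map it induces
from M(μ) does not kill the generator, so its kernel is zero by simplicity. -/
theorem exists_injective_verma [LieModule.IsIrreducible ℂ g (T.Verma μ)] :
    ∃ F : T.Verma μ →ₗ⁅ℂ,g⁆ T.DualLowestVerma μ, Function.Injective F := by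
  obtain ⟨f, hf, hf1⟩ := T.exists_whittakerVector μ 0
  let w : whittakerVectors (T.borel T.pos T.cartan_lie_pos)
    (T.borelChar T.pos T.cartan_lie_pos le_sup_right μ) (T.DualLowestVerma μ) :=
    ⟨f, T.mem_whittakerVectors_borel μ hf⟩
  refine ⟨whittakerHom w, (LieModuleHom.ker_eq_bot _).1 ?_⟩
  refine (eq_bot_or_eq_top _).resolve_right fun h => ?_
  have hmem : standardGenerator _ _ ∈ (whittakerHom w).ker := h ▸ LieSubmodule.mem_top _
  rw [LieModuleHom.mem_ker, whittakerHom_generator] at hmem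
  have hf0 : f = 0 := hmem
  rw [hf0, LinearMap.zero_apply] at hf1
  exact zero_ne_one hf1

variable {T μ} in
theorem annihilator_whittakerImage [LieModule.IsIrreducible ℂ g (T.Verma μ)]
    {χ : LieAlgebra.LieCharacter ℂ T.pos} {w : whittakerVectors T.pos χ (T.DualLowestVerma μ)}
    (hw : w ≠ 0) : annihilator g (T.whittakerImage μ χ w) = annihilator g (T.Verma μ) := by
  have := T.isIrreducible_lowestVerma μ
  obtain ⟨F, hF⟩ := T.exists_injective_verma μ
  -- Both sides now concern nonzero submodules of the dual of the simple module N(-μ).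
  rw [← annihilator_range_of_injective F hF]
  refine annihilator_eq_of_dual (whittakerImage_ne_bot hw) fun h => ?_
  have hV : Nontrivial (T.Verma μ) := LieModule.nontrivial_of_isIrreducible ℂ g _
  obtain ⟨m, hm⟩ := exists_ne (0 : T.Verma μ)
  have hmem : F m ∈ F.range := (LieModuleHom.mem_range _ _).2 ⟨m, rfl⟩
  rw [h, LieSubmodule.mem_bot] at hmem
  exact hm (hF (hmem.trans (map_zero F).symm))

end TriangularDecomposition

end WhittakerModules

end

open WhittakerModules in
theorem theorem50 {g : Type*} [LieRing g] [LieAlgebra ℂ g] (T : TriangularDecomposition g)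
    (μ : Module.Dual ℂ T.cartan) (hμ : LieModule.IsIrreducible ℂ g (T.Verma μ))
    (χ : LieAlgebra.LieCharacter ℂ T.pos) :
    Module.finrank ℂ (whittakerVectors T.pos χ (T.DualLowestVerma μ)) = 1 ∧
      ∀ w : whittakerVectors T.pos χ (T.DualLowestVerma μ), w ≠ 0 →
        annihilator g (T.whittakerImage μ χ w) = annihilator g (T.Verma μ) := by
  exact ⟨T.finrank_whittakerVectors μ χ, fun _ hw =>
    TriangularDecomposition.annihilator_whittakerImage hw⟩
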